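/- Let $n$ be a natural number, let $A$ be a positive semidefinite complex $n\times n$ matrix, and let $X,Y$ be normal complex $n\times n$ matrices. Then for every real number $p\ge 1$, $$|A(X\circ Y)A|^p \prec_{w\log} A^p\,(|X|^p\circ|Y|^p)\,A^p .$$ Here $\circ$ is the Schur (entrywise) product, $|T|=(T^*T)^{1/2}$, and real powers of positive semidefinite matrices are given by the functional calculus. For positive semidefinite $n\times n$ matrices $S,T$, with eigenvalues (counted with multiplicity) in decreasing order $\lambda_1(\cdot)\ge\cdots\ge\lambda_n(\cdot)$, the relation $S\prec_{w\log}T$ (weak log-majorization) means that $$\prod_{j=1}^k\lambda_j(S)\le\prod_{j=1}^k\lambda_j(T)\qquad\text{for all } k=1,\dots,n.$$ In particular, both matrices in the claim are positive semidefinite. -/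

import Mathlib

open scoped ComplexOrder MatrixOrder Matrix

/-- Weak log-majorization `X ≺_{w log} Y` of positive semidefinite complex matrices: both matrices
are positive semidefinite and, for every `k = 1, …, n`, the product of the `k` largest eigenvalues
of `X` is at most the product of the `k` largest eigenvalues of `Y`. Here `eigenvalues₀` lists the
eigenvalues, with multiplicity, in decreasing order, starting at index `0`. -/
def WeakLogMajorizedBy {ι : Type*} [Fintype ι] [DecidableEq ι] (X Y : Matrix ι ι ℂ) : Prop :=
  ∃ (hX : X.PosSemidef) (hY : Y.PosSemidef), ∀ k : ℕ, 1 ≤ k → k ≤ Fintype.card ι →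
    ∏ j with j.val < k, hX.isHermitian.eigenvalues₀ j ≤
      ∏ j with j.val < k, hY.isHermitian.eigenvalues₀ j

open Matrix Finset

/-! The product of the `k` largest eigenvalues of a positive semidefinite `H` is the maximum of `det
(Wᴴ H W) / det (Wᴴ W)` over injective `W` with `k` columns: Cauchy–Binet gives the bound
(`norm_det_compression_le`), top eigenvectors attain it (`exists_top_eigenvectors`). A positive
semidefinite block matrix with off-diagonal block `Q` satisfies a Cauchy–Schwarz inequality for
determinants, and this survives Schur products and compressions (`norm_det_hadamard_sq_le`).

Normality makes the block matrix with entries `|X|, X, Xᴴ, |X|` positive semidefinite, and likewise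
for `Y`, so the top singular values of `A (X ⊙ Y) A` are controlled by the eigenvalues of `A (|X| ⊙
|Y|) A`; this is the case `p = 1` (`topEigenvalueProd_abs_le`). For the exponent, let `g s` be the
top eigenvalue product of `A ^ s (|X| ^ s ⊙ |Y| ^ s) A ^ s`. The same Cauchy–Schwarz inequality
makes `g` midpoint log-convex, and `g 0 ≤ 1`, hence `g 1 ^ p ≤ g p`. -/

/-! ### Cauchy–Binet and determinants of compressions. -/

/-- Cauchy–Binet, summed over all index maps. -/
theorem factorial_mul_det_mul {ι κ R : Type*} [Fintype ι] [Fintype κ] [DecidableEq κ] [CommRing R]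
    (M : Matrix κ ι R) (N : Matrix ι κ R) :
    ((Fintype.card κ).factorial : R) * (M * N).det =
      ∑ h : κ → ι, (M.submatrix id h).det * (N.submatrix h id).det := by
  classical
  -- Every row order gives an expansion of the same determinant; summing over `σ` assembles the
  -- coefficients into minors of `M`.
  have key : ∀ σ : Equiv.Perm κ, (M * N).det =
      ∑ h : κ → ι, Equiv.Perm.sign σ * (∏ i, M (σ i) (h i)) * (N.submatrix h id).det := by
    intro σ
    have h1 : ((M * N).submatrix σ id).det =
        ∑ h : κ → ι, (∏ i, M (σ i) (h i)) * (N.submatrix h id).det := by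
      have : (M * N).submatrix σ id = fun i => ∑ j, M (σ i) j • N j := by
        ext i j
        simp [Matrix.mul_apply, Finset.sum_apply]
      rw [this]
      have := (Matrix.detRowAlternating (n := κ) (R := R)).toMultilinearMap.map_sum
        (fun (i : κ) (j : ι) => M (σ i) j • N j)
      refine this.trans (Finset.sum_congr rfl fun h _ => ?_)
      exact (Matrix.detRowAlternating (n := κ) (R := R)).toMultilinearMap.map_smul_univ
        (fun i => M (σ i) (h i)) (fun i => N (h i))
    have h2 : ((M * N).submatrix σ id).det = Equiv.Perm.sign σ * (M * N).det :=
      Matrix.det_permute σ (M * N)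
    have h3 : ((Equiv.Perm.sign σ : ℤ) : R) * ((Equiv.Perm.sign σ : ℤ) : R) = 1 := by
      rcases Int.units_eq_one_or (Equiv.Perm.sign σ) with h | h <;> simp [h]
    calc (M * N).det = (Equiv.Perm.sign σ : ℤ) * ((M * N).submatrix σ id).det := by
          rw [h2, ← mul_assoc, h3, one_mul]
      _ = _ := by rw [h1, Finset.mul_sum]; simp only [mul_assoc]
  calc ((Fintype.card κ).factorial : R) * (M * N).det
      = ∑ _σ : Equiv.Perm κ, (M * N).det := by simp [Fintype.card_perm]
    _ = ∑ σ : Equiv.Perm κ, ∑ h : κ → ι,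
          Equiv.Perm.sign σ * (∏ i, M (σ i) (h i)) * (N.submatrix h id).det :=
        Finset.sum_congr rfl fun σ _ => key σ
    _ = _ := by
        rw [Finset.sum_comm]
        refine Finset.sum_congr rfl fun h _ => ?_
        rw [Matrix.det_apply' (M.submatrix id h), Finset.sum_mul]
        rfl

/-- A set of indices carrying the largest values of `d` has the largest product among sets of the
same size. -/
theorem prod_le_prod_of_card_eq {ι : Type*} [DecidableEq ι] {d : ι → ℝ} (hd : ∀ i, 0 ≤ d i)
    {S R : Finset ι} (hS : ∀ i ∈ S, ∀ j ∉ S, d j ≤ d i) (hc : #R = #S) :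
    ∏ i ∈ R, d i ≤ ∏ i ∈ S, d i := by
  have hcard : #(R \ S) = #(S \ R) := by
    have h1 := Finset.card_sdiff_add_card_inter R S
    have h2 := Finset.card_sdiff_add_card_inter S R
    rw [Finset.inter_comm] at h2
    omega
  rw [← Finset.prod_inter_mul_prod_sdiff R S, ← Finset.prod_inter_mul_prod_sdiff S R,
    Finset.inter_comm S R]
  refine mul_le_mul_of_nonneg_left ?_ (Finset.prod_nonneg fun i _ => hd i)
  let e : ↥(R \ S) ≃ ↥(S \ R) := Finset.equivOfCardEq hcard
  rw [← Finset.prod_coe_sort (R \ S), ← Finset.prod_coe_sort (S \ R), ← e.prod_comp]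
  refine Finset.prod_le_prod (fun i _ => hd i) fun i _ => ?_
  exact hS _ (Finset.mem_sdiff.1 (e i).2).1 _ (Finset.mem_sdiff.1 i.2).2

section
variable {ι κ : Type*} [Fintype ι] [DecidableEq ι] [Fintype κ] [DecidableEq κ]

theorem factorial_mul_det_conjTranspose_mul_diagonal_mul (W : Matrix ι κ ℂ) (d : ι → ℝ) :
    ((Fintype.card κ).factorial : ℂ) * (Wᴴ * diagonal (fun i => (d i : ℂ)) * W).det =
      ((∑ h : κ → ι, ‖(W.submatrix h id).det‖ ^ 2 * ∏ i, d (h i) : ℝ) : ℂ) := by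
  rw [Matrix.mul_assoc, factorial_mul_det_mul]
  push_cast
  refine Finset.sum_congr rfl fun h _ => ?_
  have h1 : (Wᴴ.submatrix id h).det = star (W.submatrix h id).det := by
    rw [← Matrix.det_conjTranspose]; rfl
  have h2 : (diagonal (fun i => (d i : ℂ)) * W).submatrix h id =
      Matrix.of fun i j => (d (h i) : ℂ) * (W.submatrix h id) i j := by
    ext i j; simp [Matrix.diagonal_mul]
  rw [h1, h2, Matrix.det_mul_column, ← Complex.conj_mul']
  simp only [RCLike.star_def]
  ring

/-- The compression of a diagonal matrix to a `k`-dimensional space has determinant at most the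
product of its `k` largest entries. -/
theorem norm_det_compression_diagonal_le {d : ι → ℝ} (hd : ∀ i, 0 ≤ d i) {S : Finset ι}
    (hS : ∀ i ∈ S, ∀ j ∉ S, d j ≤ d i) (hc : Fintype.card κ = #S) (W : Matrix ι κ ℂ) :
    ‖(Wᴴ * diagonal (fun i => (d i : ℂ)) * W).det‖ ≤ (∏ i ∈ S, d i) * ‖(Wᴴ * W).det‖ := by
  have hf : (0 : ℝ) < (Fintype.card κ).factorial := by positivity
  have e1 := congrArg norm (factorial_mul_det_conjTranspose_mul_diagonal_mul W d)
  -- The case `d = 1` writes `det (Wᴴ W)` with the same weights, so the two sums compare term by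
  -- term.
  have e2 := congrArg norm (factorial_mul_det_conjTranspose_mul_diagonal_mul W (fun _ => 1))
  have hone : (diagonal (fun _ : ι => ((1 : ℝ) : ℂ))) = 1 := by simp
  rw [hone, Matrix.mul_one] at e2
  rw [norm_mul, Complex.norm_natCast, Complex.norm_real, Real.norm_of_nonneg] at e1 e2
  · refine le_of_mul_le_mul_left ?_ hf
    rw [e1, mul_left_comm, e2, Finset.mul_sum]
    refine Finset.sum_le_sum fun h _ => ?_
    by_cases hi : Function.Injective h
    · rw [mul_comm]
      simp only [Finset.prod_const_one, mul_one]
      refine mul_le_mul_of_nonneg_right ?_ (by positivity)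
      have hp : ∏ i, d (h i) = ∏ i ∈ Finset.univ.image h, d i := by
        rw [Finset.prod_image fun a _ b _ hab => hi hab]
      rw [hp]
      exact prod_le_prod_of_card_eq hd hS (by
        rw [Finset.card_image_of_injective _ hi, Finset.card_univ, hc])
    · obtain ⟨a, b, hab, hne⟩ : ∃ a b, h a = h b ∧ a ≠ b := by
        simpa [Function.Injective] using hi
      have h0 : (W.submatrix h id).det = 0 :=
        Matrix.det_zero_of_row_eq hne (by ext j; simp [hab])
      simp [h0]
  · exact Finset.sum_nonneg fun h _ =>
      mul_nonneg (by positivity) (Finset.prod_nonneg fun i _ => by positivity)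
  · exact Finset.sum_nonneg fun h _ =>
      mul_nonneg (by positivity) (Finset.prod_nonneg fun i _ => hd _)

/-! ### Determinant inequalities for positive semidefinite matrices. -/

/-- For invertible `P`, conjugating by `R ^ (-1/2)` reduces to a matrix between `0` and `1`, whose
eigenvalues lie in `[0, 1]`. -/
theorem norm_det_le_norm_det_of_posSemidef_sub {P R : Matrix κ κ ℂ} (hP : P.PosSemidef)
    (hPR : (R - P).PosSemidef) : ‖P.det‖ ≤ ‖R.det‖ := by
  by_cases h0 : P.det = 0
  · simp [h0]
  have hPd : P.PosDef := hP.posDef_iff_det_ne_zero.2 h0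
  have hRs : R.PosSemidef := by simpa using hP.add hPR
  let Q := CFC.sqrt R
  have hQ : Q.PosSemidef := Matrix.nonneg_iff_posSemidef.1 (CFC.sqrt_nonneg R)
  have hQQ : Q * Q = R := CFC.sqrt_mul_sqrt_self R (Matrix.nonneg_iff_posSemidef.2 hRs)
  have hRd : R.PosDef := by simpa using hPd.add_posSemidef hPR
  have hQdet : IsUnit Q.det := by
    rw [isUnit_iff_ne_zero]
    intro h
    have : R.det = 0 := by rw [← hQQ, Matrix.det_mul, h, zero_mul]
    exact hRd.det_pos.ne' this
  have hQi : (Q⁻¹)ᴴ = Q⁻¹ := by rw [Matrix.conjTranspose_nonsing_inv, hQ.1.eq]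
  have hK : (1 - Q⁻¹ * P * Q⁻¹).PosSemidef := by
    have := hPR.conjTranspose_mul_mul_same Q⁻¹
    rw [hQi, Matrix.mul_sub, Matrix.sub_mul, ← hQQ, ← mul_assoc Q⁻¹ Q Q,
      Matrix.nonsing_inv_mul _ hQdet, Matrix.one_mul, Matrix.mul_nonsing_inv _ hQdet] at this
    exact this
  have hKP : (Q⁻¹ * P * Q⁻¹).PosSemidef := by
    have := hP.conjTranspose_mul_mul_same Q⁻¹
    rwa [hQi] at this
  have hle : ‖(Q⁻¹ * P * Q⁻¹).det‖ ≤ 1 := by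
    rw [hKP.1.det_eq_prod_eigenvalues, norm_prod]
    refine Finset.prod_le_one (fun i _ => norm_nonneg _) fun i _ => ?_
    have hn := hKP.eigenvalues_nonneg i
    have hx := hK.re_dotProduct_nonneg (hKP.1.eigenvectorBasis i)
    have hb : star (⇑(hKP.1.eigenvectorBasis i)) ⬝ᵥ ⇑(hKP.1.eigenvectorBasis i) = 1 := by
      have := hKP.1.eigenvectorBasis.inner_eq_one i
      rw [EuclideanSpace.inner_eq_star_dotProduct] at this
      rw [dotProduct_comm]; exact this
    rw [Matrix.sub_mulVec, Matrix.one_mulVec, hKP.1.mulVec_eigenvectorBasis, dotProduct_sub,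
      dotProduct_smul, hb] at hx
    simp at hx
    refine (Complex.norm_real _).trans_le ?_
    exact (Real.norm_of_nonneg hn).trans_le hx
  have hdet : P.det = Q.det * (Q⁻¹ * P * Q⁻¹).det * Q.det := by
    rw [← Matrix.det_mul, ← Matrix.det_mul]
    congr 1
    rw [mul_assoc, mul_assoc, Matrix.nonsing_inv_mul _ hQdet, Matrix.mul_one, ← mul_assoc,
      Matrix.mul_nonsing_inv _ hQdet, Matrix.one_mul]
  rw [hdet, ← hQQ, Matrix.det_mul Q Q, norm_mul, norm_mul, norm_mul]
  nlinarith [mul_nonneg (norm_nonneg Q.det) (norm_nonneg Q.det)]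

/-- The Cauchy–Schwarz inequality for determinants of blocks. -/
theorem norm_det_sq_le_of_fromBlocks_posSemidef {P Q R : Matrix κ κ ℂ}
    (h : (fromBlocks P Q Qᴴ R).PosSemidef) : ‖Q.det‖ ^ 2 ≤ ‖P.det‖ * ‖R.det‖ := by
  have hP : P.PosSemidef := h.submatrix Sum.inl
  -- A kernel vector of `P`, padded by zero, is isotropic for the block matrix and hence in its
  -- kernel, so `Qᴴ` is singular too. Otherwise the Schur complement gives `Qᴴ P⁻¹ Q ≤ R`.
  by_cases h0 : P.det = 0
  · obtain ⟨v, hv, hPv⟩ := Matrix.exists_mulVec_eq_zero_iff.2 h0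
    have hz : fromBlocks P Q Qᴴ R *ᵥ Sum.elim v 0 = 0 := by
      refine (h.dotProduct_mulVec_zero_iff _).1 ?_
      rw [Matrix.fromBlocks_mulVec]
      simp [hPv, dotProduct, Fintype.sum_sum_type]
    have hQv : Qᴴ *ᵥ v = 0 := by
      rw [Matrix.fromBlocks_mulVec] at hz
      funext i
      simpa using congrFun hz (Sum.inr i)
    have : Qᴴ.det = 0 := Matrix.exists_mulVec_eq_zero_iff.1 ⟨v, hv, hQv⟩
    rw [Matrix.det_conjTranspose, star_eq_zero] at this
    simp [this, h0]
  · have hPd : P.PosDef := hP.posDef_iff_det_ne_zero.2 h0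
    have := hPd.isUnit.invertible
    have hS := (Matrix.PosDef.fromBlocks₁₁ Q R hPd).1 h
    have hle := norm_det_le_norm_det_of_posSemidef_sub
      (hPd.inv.posSemidef.conjTranspose_mul_mul_same Q) hS
    rw [Matrix.det_mul, Matrix.det_mul, Matrix.det_conjTranspose, norm_mul, norm_mul, norm_star,
      Matrix.det_nonsing_inv, Ring.inverse_eq_inv', norm_inv] at hle
    have hp : 0 < ‖P.det‖ := norm_pos_iff.2 h0
    calc ‖Q.det‖ ^ 2 = ‖P.det‖ * (‖Q.det‖ * ‖P.det‖⁻¹ * ‖Q.det‖) := by field_simp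
      _ ≤ _ := mul_le_mul_of_nonneg_left hle hp.le

omit [DecidableEq ι] in
/-- Cauchy–Schwarz for determinants of compressions of the Schur product of positive semidefinite
block matrices. -/
theorem norm_det_hadamard_sq_le {P Q R P' Q' R' : Matrix ι ι ℂ}
    (h : (fromBlocks P Q Qᴴ R).PosSemidef) (h' : (fromBlocks P' Q' Q'ᴴ R').PosSemidef)
    (W₁ W₂ : Matrix ι κ ℂ) :
    ‖(W₁ᴴ * (Q ⊙ Q') * W₂).det‖ ^ 2 ≤
      ‖(W₁ᴴ * (P ⊙ P') * W₁).det‖ * ‖(W₂ᴴ * (R ⊙ R') * W₂).det‖ := by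
  have hb := h.hadamard h'
  have hb2 : fromBlocks P Q Qᴴ R ⊙ fromBlocks P' Q' Q'ᴴ R' =
      fromBlocks (P ⊙ P') (Q ⊙ Q') (Q ⊙ Q')ᴴ (R ⊙ R') := by
    ext (i | i) (j | j) <;> simp [Matrix.hadamard]
  rw [hb2] at hb
  have hc := hb.conjTranspose_mul_mul_same (fromBlocks W₁ 0 0 W₂)
  rw [Matrix.fromBlocks_conjTranspose, Matrix.fromBlocks_multiply, Matrix.fromBlocks_multiply] at hc
  apply norm_det_sq_le_of_fromBlocks_posSemidef
  simpa [Matrix.mul_assoc] using hc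

end

/-! ### Real powers and positive semidefinite block matrices. -/

section
variable {n : Type*} [Fintype n] [DecidableEq n]

theorem Matrix.PosSemidef.rpow_eq {A : Matrix n n ℂ} (hA : A.PosSemidef) (s : ℝ) :
    A ^ s = (hA.1.eigenvectorUnitary : Matrix n n ℂ) *
      diagonal (fun i => ((hA.1.eigenvalues i ^ s : ℝ) : ℂ)) *
      (hA.1.eigenvectorUnitary : Matrix n n ℂ)ᴴ := by
  rw [CFC.rpow_eq_cfc_real (Matrix.nonneg_iff_posSemidef.2 hA), hA.1.cfc_eq, Matrix.IsHermitian.cfc,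
    Unitary.conjStarAlgAut_apply]
  rfl

theorem Matrix.IsHermitian.eigenvectorUnitary_conjTranspose_mul {A : Matrix n n ℂ}
    (hA : A.IsHermitian) :
    (hA.eigenvectorUnitary : Matrix n n ℂ)ᴴ * (hA.eigenvectorUnitary : Matrix n n ℂ) = 1 :=
  Unitary.coe_star_mul_self hA.eigenvectorUnitary

theorem Matrix.posSemidef_rpow (A : Matrix n n ℂ) (s : ℝ) : (A ^ s).PosSemidef :=
  Matrix.nonneg_iff_posSemidef.1 CFC.rpow_nonneg

theorem Matrix.PosSemidef.rpow_add {A : Matrix n n ℂ} (hA : A.PosSemidef) {s t : ℝ} (hs : 0 ≤ s)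
    (ht : 0 ≤ t) : A ^ (s + t) = A ^ s * A ^ t := by
  simp only [hA.rpow_eq]
  simp only [Matrix.mul_assoc]
  rw [← Matrix.mul_assoc _ᴴ _ (_ * _), hA.1.eigenvectorUnitary_conjTranspose_mul, Matrix.one_mul,
    ← Matrix.mul_assoc (diagonal _) (diagonal _), diagonal_mul_diagonal]
  simp only [← Complex.ofReal_mul, Real.rpow_add_of_nonneg (hA.eigenvalues_nonneg _) hs ht]

theorem Matrix.PosSemidef.continuousAt_rpow {A : Matrix n n ℂ} (hA : A.PosSemidef) {s : ℝ}
    (hs : 0 < s) : ContinuousAt (fun t : ℝ => A ^ t) s := by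
  simp only [hA.rpow_eq]
  have h : ContinuousAt (fun t : ℝ =>
      (diagonal (fun i => ((hA.1.eigenvalues i ^ t : ℝ) : ℂ)) : Matrix n n ℂ)) s := by
    have h1 : ContinuousAt (fun t : ℝ => fun i => ((hA.1.eigenvalues i ^ t : ℝ) : ℂ)) s :=
      continuousAt_pi.2 fun i =>
        Complex.continuous_ofReal.continuousAt.comp (Real.continuousAt_const_rpow' hs.ne')
    exact (Continuous.matrix_diagonal continuous_id).continuousAt.comp h1
  exact (continuousAt_const.mul h).mul continuousAt_const

/-- With `D = diag(|X|, |X|)`, normality gives `M² = 2 D M`. A unit eigenvector `v` with eigenvalue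
`μ ≠ 0` then satisfies `μ v = 2 D v`, so `μ = 2 ⟨v, D v⟩ ≥ 0`. -/
theorem fromBlocks_abs_posSemidef {X : Matrix n n ℂ} (hX : IsStarNormal X) :
    (fromBlocks (CFC.abs X) X Xᴴ (CFC.abs X)).PosSemidef := by
  set P := CFC.abs X with hPdef
  have hP : P.PosSemidef := Matrix.nonneg_iff_posSemidef.1 (CFC.abs_nonneg X)
  have hPP : P * P = Xᴴ * X := CFC.abs_mul_abs X
  have hPP' : P * P = X * Xᴴ := hPP.trans hX.star_comm_self
  have hc : P * X = X * P := (CFC.commute_abs_self X).eq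
  have hc' : P * Xᴴ = Xᴴ * P := by
    have := congrArg conjTranspose hc
    rwa [conjTranspose_mul, conjTranspose_mul, hP.1.eq, eq_comm] at this
  set M := fromBlocks P X Xᴴ P
  have hM : M.IsHermitian := by
    refine IsHermitian.fromBlocks hP.1 rfl hP.1
  have hD : (fromBlocks P 0 0 P).PosSemidef := by
    have h1 : (fromBlocks P 0 0ᴴ P).PosSemidef := by
      have e : fromBlocks P (0 : Matrix n n ℂ) 0ᴴ P =
          (fromBlocks (CFC.sqrt P) 0 0 (CFC.sqrt P))ᴴ * fromBlocks (CFC.sqrt P) 0 0 (CFC.sqrt P) := by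
        have h2 : (CFC.sqrt P)ᴴ = CFC.sqrt P :=
          (Matrix.nonneg_iff_posSemidef.1 (CFC.sqrt_nonneg P)).1.eq
        have h3 : CFC.sqrt P * CFC.sqrt P = P :=
          CFC.sqrt_mul_sqrt_self P (Matrix.nonneg_iff_posSemidef.2 hP)
        simp [fromBlocks_conjTranspose, fromBlocks_multiply, h2, h3]
      rw [e]
      exact posSemidef_conjTranspose_mul_self _
    simpa using h1
  have hMM : M * M = (2 : ℂ) • (fromBlocks P 0 0 P * M) := by
    simp only [M, fromBlocks_multiply, fromBlocks_smul]
    simp [← hPP', ← hPP, hc, hc', two_smul]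
  refine hM.posSemidef_iff_eigenvalues_nonneg.2 fun i => ?_
  by_contra hneg
  have hne : (hM.eigenvalues i : ℂ) ≠ 0 := by
    intro h
    exact hneg (by simp [Complex.ofReal_eq_zero.1 h])
  set v := ⇑(hM.eigenvectorBasis i) with hv
  have hMv : M *ᵥ v = (hM.eigenvalues i : ℂ) • v := hM.mulVec_eigenvectorBasis i
  have h1 : (hM.eigenvalues i : ℂ) • ((hM.eigenvalues i : ℂ) • v) =
      (hM.eigenvalues i : ℂ) • ((2 : ℂ) • (fromBlocks P 0 0 P *ᵥ v)) := by
    have h2 := congrArg (· *ᵥ v) hMM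
    simp only [← mulVec_mulVec, smul_mulVec, hMv, mulVec_smul] at h2
    rw [h2, smul_comm]
  have h3 := smul_right_injective _ hne h1
  have hb : star v ⬝ᵥ v = 1 := by
    have := hM.eigenvectorBasis.inner_eq_one i
    rw [EuclideanSpace.inner_eq_star_dotProduct] at this
    rw [dotProduct_comm]; exact this
  have h4 := congrArg (fun w => (star v ⬝ᵥ w).re) h3
  have h5 := hD.re_dotProduct_nonneg v
  simp [dotProduct_smul, hb] at h4
  refine hneg ?_
  change 0 ≤ hM.eigenvalues i
  rw [h4]
  have h6 : 0 ≤ (star v ⬝ᵥ (fromBlocks P 0 0 P *ᵥ v)).re := h5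
  linarith

/-- This is the Gram matrix of the block row `(P ^ (t / 2), P ^ (s / 2))`. -/
theorem Matrix.PosSemidef.fromBlocks_rpow {P : Matrix n n ℂ} (hP : P.PosSemidef) {s t : ℝ}
    (hs : 0 ≤ s) (ht : 0 ≤ t) :
    (fromBlocks (P ^ t) (P ^ ((s + t) / 2)) (P ^ ((s + t) / 2))ᴴ (P ^ s)).PosSemidef := by
  have e : fromBlocks (P ^ t) (P ^ ((s + t) / 2)) (P ^ ((s + t) / 2))ᴴ (P ^ s) =
      (fromBlocks (P ^ (t / 2)) (P ^ (s / 2)) 0 0)ᴴ *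
        fromBlocks (P ^ (t / 2)) (P ^ (s / 2)) 0 0 := by
    have h1 : ∀ r : ℝ, (P ^ r)ᴴ = P ^ r := fun r => (posSemidef_rpow P r).1.eq
    simp only [fromBlocks_conjTranspose, fromBlocks_multiply, h1, conjTranspose_zero,
      Matrix.mul_zero, add_zero]
    rw [← hP.rpow_add (by positivity) (by positivity), ← hP.rpow_add (by positivity) (by positivity),
      ← hP.rpow_add (by positivity) (by positivity), ← hP.rpow_add (by positivity) (by positivity)]
    ring_nf
  rw [e]
  exact posSemidef_conjTranspose_mul_self _

/-- The indices of the `k` largest eigenvalues. -/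
noncomputable def topIndices (n : Type*) [Fintype n] [DecidableEq n] (k : ℕ) : Finset n :=
  {i | ((Fintype.equivOfCardEq (Fintype.card_fin (Fintype.card n)) :
    Fin (Fintype.card n) ≃ n).symm i).val < k}

theorem Matrix.IsHermitian.eigenvalues_le_of_mem_topIndices {H : Matrix n n ℂ} (hH : H.IsHermitian)
    {k : ℕ} : ∀ i ∈ topIndices n k, ∀ j ∉ topIndices n k, hH.eigenvalues j ≤ hH.eigenvalues i := by
  intro i hi j hj
  simp only [topIndices, Finset.mem_filter_univ] at hi hj
  refine hH.eigenvalues₀_antitone ?_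
  rw [Fin.le_def]
  omega

theorem Matrix.IsHermitian.prod_eigenvalues₀_eq {H : Matrix n n ℂ} (hH : H.IsHermitian) (k : ℕ) :
    ∏ j with j.val < k, hH.eigenvalues₀ j = ∏ i ∈ topIndices n k, hH.eigenvalues i := by
  refine Finset.prod_equiv (Fintype.equivOfCardEq (Fintype.card_fin (Fintype.card n))) ?_ ?_
  · intro i; simp [topIndices]
  · intro i _; simp [IsHermitian.eigenvalues]

end

/-! ### Products of top eigenvalues as extremal determinants. -/

section
variable {n : Type*} [Fintype n] [DecidableEq n]

/-- The product of the `k` largest eigenvalues. -/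
noncomputable def topEigenvalueProd (k : ℕ) {H : Matrix n n ℂ} (hH : H.PosSemidef) : ℝ :=
  ∏ i ∈ topIndices n k, hH.1.eigenvalues i

theorem topEigenvalueProd_nonneg (k : ℕ) {H : Matrix n n ℂ} (hH : H.PosSemidef) :
    0 ≤ topEigenvalueProd k hH :=
  Finset.prod_nonneg fun i _ => hH.eigenvalues_nonneg i

theorem topEigenvalueProd_congr (k : ℕ) {H K : Matrix n n ℂ} (hH : H.PosSemidef)
    (hK : K.PosSemidef) (h : H = K) : topEigenvalueProd k hH = topEigenvalueProd k hK := by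
  subst h; rfl

theorem norm_det_unitary_conj_diagonal_le {κ : Type*} [Fintype κ] [DecidableEq κ]
    {U : Matrix n n ℂ} (hU : Uᴴ * U = 1) {d : n → ℝ} (hd : ∀ i, 0 ≤ d i) {S : Finset n}
    (hS : ∀ i ∈ S, ∀ j ∉ S, d j ≤ d i) (hc : Fintype.card κ = #S) (W : Matrix n κ ℂ) :
    ‖(Wᴴ * (U * diagonal (fun i => (d i : ℂ)) * Uᴴ) * W).det‖ ≤
      (∏ i ∈ S, d i) * ‖(Wᴴ * W).det‖ := by
  have hU' : U * Uᴴ = 1 := mul_eq_one_comm.1 hU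
  have h := norm_det_compression_diagonal_le hd hS hc (Uᴴ * W)
  have e1 : (Uᴴ * W)ᴴ * (Uᴴ * W) = Wᴴ * W := by
    rw [conjTranspose_mul, conjTranspose_conjTranspose, Matrix.mul_assoc, ← Matrix.mul_assoc U,
      hU', Matrix.one_mul]
  rw [e1, conjTranspose_mul, conjTranspose_conjTranspose] at h
  simpa only [Matrix.mul_assoc] using h

theorem unitary_conj_diagonal_mul_submatrix {U : Matrix n n ℂ} (hU : Uᴴ * U = 1) (d : n → ℂ)
    (S : Finset n) :
    (U * diagonal d * Uᴴ) * U.submatrix id (Subtype.val : S → n) =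
      U.submatrix id (Subtype.val : S → n) * diagonal (fun i : S => d i) := by
  have h1 : U.submatrix id (Subtype.val : S → n) =
      U * (1 : Matrix n n ℂ).submatrix id (Subtype.val : S → n) := by
    ext i j; simp [Matrix.mul_apply, Matrix.one_apply]
  rw [h1, Matrix.mul_assoc _ Uᴴ, ← Matrix.mul_assoc Uᴴ, hU, Matrix.one_mul, Matrix.mul_assoc,
    Matrix.mul_assoc]
  congr 1
  ext i j
  rw [Matrix.diagonal_mul, Matrix.mul_diagonal, mul_comm]
  simp only [submatrix_apply, id, Matrix.one_apply]
  split_ifs with h <;> simp [h]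

theorem submatrix_conjTranspose_mul_submatrix {U : Matrix n n ℂ} (hU : Uᴴ * U = 1)
    (S : Finset n) :
    (U.submatrix id (Subtype.val : S → n))ᴴ * U.submatrix id (Subtype.val : S → n) = 1 := by
  have h : (U.submatrix id (Subtype.val : S → n))ᴴ * U.submatrix id (Subtype.val : S → n) =
      (Uᴴ * U).submatrix Subtype.val Subtype.val := rfl
  rw [h, hU, Matrix.submatrix_one _ Subtype.val_injective]

theorem Matrix.IsHermitian.eq_unitary_conj_diagonal {H : Matrix n n ℂ} (hH : H.IsHermitian) :
    H = (hH.eigenvectorUnitary : Matrix n n ℂ) *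
      diagonal (fun i => ((hH.eigenvalues i : ℝ) : ℂ)) *
      (hH.eigenvectorUnitary : Matrix n n ℂ)ᴴ := by
  conv_lhs => rw [hH.spectral_theorem, Unitary.conjStarAlgAut_apply]
  rfl

theorem norm_det_compression_le {k : ℕ} {H : Matrix n n ℂ} (hH : H.PosSemidef)
    (W : Matrix n (topIndices n k) ℂ) :
    ‖(Wᴴ * H * W).det‖ ≤ topEigenvalueProd k hH * ‖(Wᴴ * W).det‖ := by
  conv_lhs => rw [hH.1.eq_unitary_conj_diagonal]
  exact norm_det_unitary_conj_diagonal_le hH.1.eigenvectorUnitary_conjTranspose_mul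
    hH.eigenvalues_nonneg hH.1.eigenvalues_le_of_mem_topIndices (Fintype.card_coe _) W

theorem exists_top_eigenvectors (k : ℕ) {H : Matrix n n ℂ} (hH : H.PosSemidef) :
    ∃ (V : Matrix n (topIndices n k) ℂ) (L : Matrix (topIndices n k) (topIndices n k) ℂ),
      Vᴴ * V = 1 ∧ H * V = V * L ∧ ‖L.det‖ = topEigenvalueProd k hH := by
  have hU := hH.1.eigenvectorUnitary_conjTranspose_mul
  refine ⟨(hH.1.eigenvectorUnitary : Matrix n n ℂ).submatrix id Subtype.val,
    diagonal fun i => ((hH.1.eigenvalues i : ℝ) : ℂ),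
    submatrix_conjTranspose_mul_submatrix hU _, ?_, ?_⟩
  · have h := unitary_conj_diagonal_mul_submatrix hU (fun i => ((hH.1.eigenvalues i : ℝ) : ℂ))
      (topIndices n k)
    rwa [← hH.1.eq_unitary_conj_diagonal] at h
  · rw [det_diagonal, norm_prod, topEigenvalueProd, ← Finset.prod_coe_sort (topIndices n k)]
    refine Finset.prod_congr rfl fun i _ => ?_
    rw [Complex.norm_real, Real.norm_of_nonneg (hH.eigenvalues_nonneg _)]

theorem topEigenvalueProd_one_le (k : ℕ) (h : (1 : Matrix n n ℂ).PosSemidef) :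
    topEigenvalueProd k h ≤ 1 := by
  obtain ⟨V, L, hV, hL, hd⟩ := exists_top_eigenvectors k h
  have : L = 1 := by
    have := congrArg (Vᴴ * ·) hL
    simp only [Matrix.one_mul, ← Matrix.mul_assoc, hV] at this
    exact this.symm
  rw [← hd, this]; simp

/-! ### Log-convexity in the exponent. -/

/-- `A ^ s (P ^ s ⊙ Q ^ s) A ^ s`. -/
noncomputable def rpowSandwich (A P Q : Matrix n n ℂ) (s : ℝ) : Matrix n n ℂ :=
  A ^ s * ((P ^ s) ⊙ (Q ^ s)) * A ^ s

theorem rpowSandwich_posSemidef (A P Q : Matrix n n ℂ) (s : ℝ) :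
    (rpowSandwich A P Q s).PosSemidef := by
  have h := ((posSemidef_rpow P s).hadamard (posSemidef_rpow Q s)).conjTranspose_mul_mul_same (A ^ s)
  rwa [(posSemidef_rpow A s).1.eq] at h

omit [DecidableEq n] in
theorem norm_det_conjTranspose_mul_self_pos {κ : Type*} [Fintype κ] [DecidableEq κ]
    {W : Matrix n κ ℂ} (hW : ∀ v, W *ᵥ v = 0 → v = 0) : 0 < ‖(Wᴴ * W).det‖ := by
  refine norm_pos_iff.2 fun h0 => ?_
  obtain ⟨v, hv, hWv⟩ := Matrix.exists_mulVec_eq_zero_iff.2 h0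
  refine hv (hW v ?_)
  rwa [← Matrix.conjTranspose_mul_self_mulVec_eq_zero]

/-- Midpoint log-convexity in the exponent. -/
theorem topEigenvalueProd_rpowSandwich_midpoint {A P Q : Matrix n n ℂ} (hA : A.PosSemidef)
    (hP : P.PosSemidef) (hQ : Q.PosSemidef) (k : ℕ) {s t : ℝ} (hs : 0 ≤ s) (hst : s ≤ t) :
    topEigenvalueProd k (rpowSandwich_posSemidef A P Q ((s + t) / 2)) ^ 2 ≤
      topEigenvalueProd k (rpowSandwich_posSemidef A P Q s) *
        topEigenvalueProd k (rpowSandwich_posSemidef A P Q t) := by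
  have ht : 0 ≤ t := hs.trans hst
  obtain ⟨V, L, hV, hL, hd⟩ :=
    exists_top_eigenvectors k (rpowSandwich_posSemidef A P Q ((s + t) / 2))
  rw [← hd]
  by_cases h0 : L.det = 0
  · simpa [h0] using mul_nonneg (topEigenvalueProd_nonneg k _) (topEigenvalueProd_nonneg k _)
  set B := (P ^ ((s + t) / 2)) ⊙ (Q ^ ((s + t) / 2)) with hB
  -- This shift carries the invariant subspace of the midpoint matrix to one of `A ^ t B A ^ s`,
  -- with the same `L`. The cross term between `A ^ t W` and `A ^ s W` becomes `Wᴴ W L`, and the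
  -- diagonal terms are compressions at exponents `t` and `s`.
  set W := A ^ ((t - s) / 2) * V with hWdef
  have hsW : A ^ s * W = A ^ ((s + t) / 2) * V := by
    rw [hWdef, ← Matrix.mul_assoc, ← hA.rpow_add hs (by linarith)]
    congr 2; ring
  have htA : A ^ t = A ^ ((t - s) / 2) * A ^ ((s + t) / 2) := by
    rw [← hA.rpow_add (by linarith) (by linarith)]
    congr 1; ring
  have hHV : A ^ ((s + t) / 2) * B * (A ^ s * W) = V * L := by
    rw [hsW, ← Matrix.mul_assoc, ← hL]; rfl
  have hWL : A ^ t * B * A ^ s * W = W * L := by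
    rw [htA, hWdef, Matrix.mul_assoc _ V L, ← hHV]
    simp only [Matrix.mul_assoc, hWdef]
  have hWinj : ∀ v, W *ᵥ v = 0 → v = 0 := by
    intro v hv
    have h1 : (V * L) *ᵥ v = 0 := by
      rw [← hHV, ← Matrix.mul_assoc, ← mulVec_mulVec, hv, mulVec_zero]
    have h2 : L *ᵥ v = 0 := by
      rw [← Matrix.one_mulVec (L *ᵥ v), ← hV, mulVec_mulVec, Matrix.mul_assoc, ← mulVec_mulVec, h1,
        mulVec_zero]
    by_contra hne
    exact h0 (Matrix.exists_mulVec_eq_zero_iff.1 ⟨v, hne, h2⟩)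
  have hpos := norm_det_conjTranspose_mul_self_pos hWinj
  have hAH : ∀ r : ℝ, (A ^ r)ᴴ = A ^ r := fun r => (posSemidef_rpow A r).1.eq
  have hcs := norm_det_hadamard_sq_le (hP.fromBlocks_rpow hs ht) (hQ.fromBlocks_rpow hs ht)
    (A ^ t * W) (A ^ s * W)
  have e1 : (A ^ t * W)ᴴ * ((P ^ ((s + t) / 2)) ⊙ (Q ^ ((s + t) / 2))) * (A ^ s * W) =
      Wᴴ * W * L := by
    rw [conjTranspose_mul, hAH, Matrix.mul_assoc Wᴴ W L, ← hWL]
    simp only [Matrix.mul_assoc, hB]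
  have e2 : ∀ r : ℝ, (A ^ r * W)ᴴ * ((P ^ r) ⊙ (Q ^ r)) * (A ^ r * W) =
      Wᴴ * rpowSandwich A P Q r * W := by
    intro r
    rw [conjTranspose_mul, hAH, rpowSandwich]
    simp only [Matrix.mul_assoc]
  rw [e1, e2, e2, det_mul, norm_mul] at hcs
  have b1 := norm_det_compression_le (rpowSandwich_posSemidef A P Q t) W
  have b2 := norm_det_compression_le (rpowSandwich_posSemidef A P Q s) W
  have b3 := hcs.trans (mul_le_mul b1 b2 (norm_nonneg _)
    (mul_nonneg (topEigenvalueProd_nonneg k _) hpos.le))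
  refine le_of_mul_le_mul_left ?_ (pow_pos hpos 2)
  linarith [b3]

/-- Induction on the dyadic level: even numerators come from the previous level, odd ones are
midpoints of two neighbours. -/
theorem le_rpow_dyadic_of_midpoint {g : ℝ → ℝ} (hg : ∀ s, 0 ≤ g s) (h0 : g 0 ≤ 1)
    (hmid : ∀ s t, 0 ≤ s → s ≤ t → g ((s + t) / 2) ^ 2 ≤ g s * g t) {p : ℝ} (hp : 0 ≤ p) (N : ℕ) :
    ∀ j : ℕ, j ≤ 2 ^ N → g (p * (j / 2 ^ N)) ≤ g p ^ ((j : ℝ) / 2 ^ N) := by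
  induction N with
  | zero =>
    intro j hj
    obtain rfl | rfl : j = 0 ∨ j = 1 := by simp at hj; omega
    · simpa using h0
    · simp
  | succ N ih =>
    intro j hj
    rw [pow_succ] at hj
    obtain ⟨i, rfl | rfl⟩ : ∃ i, j = 2 * i ∨ j = 2 * i + 1 := ⟨j / 2, by omega⟩
    · have e : ((2 * i : ℕ) : ℝ) / 2 ^ (N + 1) = i / 2 ^ N := by
        push_cast; rw [pow_succ]; field_simp
      rw [e]; exact ih i (by omega)
    · have h1 := ih i (by omega)
      have h2 := ih (i + 1) (by omega)
      have e : ((2 * i + 1 : ℕ) : ℝ) / 2 ^ (N + 1) = (i / 2 ^ N + (i + 1 : ℕ) / 2 ^ N) / 2 := by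
        push_cast; rw [pow_succ]; field_simp; ring
      rw [e]
      set x : ℝ := i / 2 ^ N
      set y : ℝ := (i + 1 : ℕ) / 2 ^ N
      have hx : 0 ≤ x := by positivity
      have hxy : x ≤ y := by simp only [x, y]; gcongr; simp
      have h3 := hmid (p * x) (p * y) (by positivity) (by gcongr)
      rw [← mul_add, mul_div_assoc] at h3
      refine le_of_sq_le_sq (h3.trans ?_) (Real.rpow_nonneg (hg p) _)
      calc g (p * x) * g (p * y) ≤ g p ^ x * g p ^ y :=
            mul_le_mul h1 h2 (hg _) (Real.rpow_nonneg (hg p) _)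
        _ = _ := by
            rw [← Real.rpow_add_of_nonneg (hg p) hx (hx.trans hxy), ← Real.rpow_natCast,
              ← Real.rpow_mul (hg p)]
            congr 1; push_cast; ring

open Filter Topology in
theorem topEigenvalueProd_rpowSandwich_one_rpow_le {A P Q : Matrix n n ℂ} (hA : A.PosSemidef)
    (hP : P.PosSemidef) (hQ : Q.PosSemidef) (k : ℕ) {p : ℝ} (hp : 1 ≤ p) :
    topEigenvalueProd k (rpowSandwich_posSemidef A P Q 1) ^ p ≤
      topEigenvalueProd k (rpowSandwich_posSemidef A P Q p) := by
  have hp0 : 0 < p := by linarith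
  set g : ℝ → ℝ := fun s => topEigenvalueProd k (rpowSandwich_posSemidef A P Q s)
  have hg : ∀ s, 0 ≤ g s := fun s => topEigenvalueProd_nonneg k _
  have hg0 : g 0 ≤ 1 := by
    have e : rpowSandwich A P Q 0 = 1 := by
      rw [rpowSandwich, CFC.rpow_zero A (nonneg_iff_posSemidef.2 hA),
        CFC.rpow_zero P (nonneg_iff_posSemidef.2 hP), CFC.rpow_zero Q (nonneg_iff_posSemidef.2 hQ), Matrix.mul_one, Matrix.one_mul]
      ext i j
      simp [Matrix.one_apply]
    exact (topEigenvalueProd_congr k _ PosSemidef.one e).trans_le (topEigenvalueProd_one_le k _)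
  have hdy := le_rpow_dyadic_of_midpoint hg hg0
    (fun s t hs hst => topEigenvalueProd_rpowSandwich_midpoint hA hP hQ k hs hst) hp0.le
  -- Dyadic approximations of `1 / p`, so that `p * θ N` tends to `1`.
  set θ : ℕ → ℝ := fun N => (⌊p⁻¹ * 2 ^ N⌋₊ : ℝ) / 2 ^ N with hθ
  have hθt : Tendsto θ atTop (𝓝 p⁻¹) :=
    (tendsto_nat_floor_mul_div_atTop (inv_nonneg.2 hp0.le)).comp
      (tendsto_pow_atTop_atTop_of_one_lt one_lt_two)
  have hle : ∀ N, g (p * θ N) ≤ g p ^ θ N := by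
    intro N
    refine hdy N _ ?_
    have h1 : p⁻¹ * 2 ^ N ≤ ((2 ^ N : ℕ) : ℝ) := by
      push_cast
      exact mul_le_of_le_one_left (by positivity) (inv_le_one_of_one_le₀ hp)
    exact Nat.floor_le_of_le h1
  -- Freezing the top eigenvectors at exponent `1` gives a lower bound for `g` that is continuous
  -- there and exact at `1`; continuity of eigenvalues is not needed.
  obtain ⟨V, L, hV, hL, hd⟩ := exists_top_eigenvectors k (rpowSandwich_posSemidef A P Q 1)
  have hcont : ContinuousAt (fun s => ‖(Vᴴ * rpowSandwich A P Q s * V).det‖) 1 := by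
    have c1 := hA.continuousAt_rpow one_pos
    have c2 := hP.continuousAt_rpow one_pos
    have c3 := hQ.continuousAt_rpow one_pos
    have c4 : ContinuousAt (fun s : ℝ => (P ^ s) ⊙ (Q ^ s)) 1 :=
      continuousAt_pi.2 fun i => continuousAt_pi.2 fun j =>
        (continuousAt_pi.1 (continuousAt_pi.1 c2 i) j).mul
          (continuousAt_pi.1 (continuousAt_pi.1 c3 i) j)
    have c5 : ContinuousAt (fun s => rpowSandwich A P Q s) 1 := (c1.mul c4).mul c1
    have c6 : Continuous fun M : Matrix n n ℂ => ‖(Vᴴ * M * V).det‖ := by fun_prop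
    exact ContinuousAt.comp (f := fun s => rpowSandwich A P Q s) c6.continuousAt c5
  have hpθ : Tendsto (fun N => p * θ N) atTop (𝓝 1) := by
    have := hθt.const_mul p
    rwa [mul_inv_cancel₀ hp0.ne'] at this
  have hlim := hcont.tendsto.comp hpθ
  have hval : ‖(Vᴴ * rpowSandwich A P Q 1 * V).det‖ = g 1 := by
    rw [Matrix.mul_assoc, hL, ← Matrix.mul_assoc, hV, Matrix.one_mul, hd]
  rw [hval] at hlim
  have hlim2 : Tendsto (fun N => g p ^ θ N) atTop (𝓝 (g p ^ p⁻¹)) :=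
    (Real.continuousAt_const_rpow' (inv_ne_zero hp0.ne')).tendsto.comp hθt
  have hfin : g 1 ≤ g p ^ p⁻¹ := by
    refine le_of_tendsto_of_tendsto' hlim hlim2 fun N => ?_
    have := norm_det_compression_le (rpowSandwich_posSemidef A P Q (p * θ N)) V
    rw [hV, det_one, norm_one, mul_one] at this
    exact this.trans (hle N)
  calc g 1 ^ p ≤ (g p ^ p⁻¹) ^ p := Real.rpow_le_rpow (hg 1) hfin hp0.le
    _ = g p := Real.rpow_inv_rpow (hg p) hp0.ne'

/-! ### Singular values and the conclusion. -/

/-- The product of the `k` largest singular values of `A (X ⊙ Y) A`. -/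
theorem topEigenvalueProd_abs_le {A X Y : Matrix n n ℂ} (hA : A.PosSemidef)
    (hX : IsStarNormal X) (hY : IsStarNormal Y) (k : ℕ)
    (hT : (CFC.abs (A * (X ⊙ Y) * A)).PosSemidef) :
    topEigenvalueProd k hT ≤
      topEigenvalueProd k (rpowSandwich_posSemidef A (CFC.abs X) (CFC.abs Y) 1) := by
  set T := A * (X ⊙ Y) * A with hTdef
  obtain ⟨V, L, hV, hL, hd⟩ := exists_top_eigenvectors k hT
  set c := topEigenvalueProd k (rpowSandwich_posSemidef A (CFC.abs X) (CFC.abs Y) 1)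
  have hc : 0 ≤ c := topEigenvalueProd_nonneg k _
  rw [← hd]
  by_cases h0 : L.det = 0
  · simpa [h0] using hc
  have hWW : (T * V)ᴴ * (T * V) = Lᴴ * L := by
    have h1 : Tᴴ * T = (CFC.abs T)ᴴ * CFC.abs T := by
      rw [hT.1.eq]; exact (CFC.abs_mul_abs T).symm
    calc (T * V)ᴴ * (T * V) = Vᴴ * (Tᴴ * T) * V := by
          simp only [conjTranspose_mul, Matrix.mul_assoc]
      _ = (CFC.abs T * V)ᴴ * (CFC.abs T * V) := by
          rw [h1]; simp only [conjTranspose_mul, Matrix.mul_assoc]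
      _ = Lᴴ * (Vᴴ * V) * L := by rw [hL]; simp only [conjTranspose_mul, Matrix.mul_assoc]
      _ = _ := by rw [hV, Matrix.mul_one]
  -- Testing against `A T V` and `A V` makes the cross term `(T V)ᴴ (T V) = Lᴴ L`, which yields
  -- `‖det L‖⁴ ≤ c² ‖det L‖²`.
  have hcs := norm_det_hadamard_sq_le (fromBlocks_abs_posSemidef hX) (fromBlocks_abs_posSemidef hY)
    (A * (T * V)) (A * V)
  have e1 : (A * (T * V))ᴴ * (X ⊙ Y) * (A * V) = (T * V)ᴴ * (T * V) := by
    rw [conjTranspose_mul, hA.1.eq, hTdef]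
    simp only [Matrix.mul_assoc]
  have e2 : ∀ W : Matrix n (topIndices n k) ℂ,
      (A * W)ᴴ * (CFC.abs X ⊙ CFC.abs Y) * (A * W) =
        Wᴴ * rpowSandwich A (CFC.abs X) (CFC.abs Y) 1 * W := by
    intro W
    rw [conjTranspose_mul, hA.1.eq, rpowSandwich, CFC.rpow_one A (nonneg_iff_posSemidef.2 hA),
      CFC.rpow_one _ (CFC.abs_nonneg X), CFC.rpow_one _ (CFC.abs_nonneg Y)]
    simp only [Matrix.mul_assoc]
  rw [e1, e2, e2, hWW] at hcs
  have b1 := norm_det_compression_le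
    (rpowSandwich_posSemidef A (CFC.abs X) (CFC.abs Y) 1) (T * V)
  have b2 := norm_det_compression_le (rpowSandwich_posSemidef A (CFC.abs X) (CFC.abs Y) 1) V
  rw [hWW] at b1
  rw [hV, det_one, norm_one, mul_one] at b2
  have b3 := hcs.trans (mul_le_mul b1 b2 (norm_nonneg _) (mul_nonneg hc (norm_nonneg _)))
  rw [det_mul, det_conjTranspose, norm_mul, norm_star] at b3
  have hl : 0 < ‖L.det‖ := norm_pos_iff.2 h0
  refine le_of_sq_le_sq ?_ hc
  refine le_of_mul_le_mul_left ?_ (pow_pos hl 2)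
  linarith [b3]

theorem topEigenvalueProd_rpow (k : ℕ) {H : Matrix n n ℂ} (hH : H.PosSemidef) {p : ℝ}
    (hp : 0 ≤ p) (hHp : (H ^ p).PosSemidef) :
    topEigenvalueProd k hHp ≤ topEigenvalueProd k hH ^ p := by
  obtain ⟨V, L, hV, hL, hd⟩ := exists_top_eigenvectors k hHp
  have h1 := norm_det_unitary_conj_diagonal_le hH.1.eigenvectorUnitary_conjTranspose_mul
    (fun i => Real.rpow_nonneg (hH.eigenvalues_nonneg i) p) (S := topIndices n k)
    (fun i hi j hj => Real.rpow_le_rpow (hH.eigenvalues_nonneg j)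
      (hH.1.eigenvalues_le_of_mem_topIndices i hi j hj) hp) (Fintype.card_coe _) V
  rw [← hH.rpow_eq, Matrix.mul_assoc, hL, ← Matrix.mul_assoc, hV, Matrix.one_mul, hd, det_one,
    norm_one, mul_one, Real.finsetProd_rpow _ _ fun i _ => hH.eigenvalues_nonneg i] at h1
  exact h1

end

theorem mainTheorem8 (n : ℕ) (A X Y : Matrix (Fin n) (Fin n) ℂ) (hA : A.PosSemidef)
    (hX : IsStarNormal X) (hY : IsStarNormal Y) (p : ℝ) (hp : 1 ≤ p) :
    WeakLogMajorizedBy (CFC.abs (A * (X ⊙ Y) * A) ^ p)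
      (A ^ p * ((CFC.abs X ^ p) ⊙ (CFC.abs Y ^ p)) * A ^ p) := by
  have habs : ∀ T : Matrix (Fin n) (Fin n) ℂ, (CFC.abs T).PosSemidef :=
    fun T => nonneg_iff_posSemidef.1 (CFC.abs_nonneg T)
  refine ⟨posSemidef_rpow _ p, rpowSandwich_posSemidef A (CFC.abs X) (CFC.abs Y) p,
    fun k _ _ => ?_⟩
  rw [IsHermitian.prod_eigenvalues₀_eq, IsHermitian.prod_eigenvalues₀_eq]
  have hp0 : 0 ≤ p := by linarith
  calc _ ≤ topEigenvalueProd k (habs (A * (X ⊙ Y) * A)) ^ p :=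
        topEigenvalueProd_rpow k (habs _) hp0 (posSemidef_rpow _ p)
    _ ≤ topEigenvalueProd k (rpowSandwich_posSemidef A (CFC.abs X) (CFC.abs Y) 1) ^ p :=
        Real.rpow_le_rpow (topEigenvalueProd_nonneg k _)
          (topEigenvalueProd_abs_le hA hX hY k (habs _)) hp0
    _ ≤ _ := topEigenvalueProd_rpowSandwich_one_rpow_le hA (habs X) (habs Y) k hp
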